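/- Let $p$ be an odd prime, let $(\frac{\cdot}{p})$ be the Legendre symbol, and let $d\in\mathbb Z$ with $(\frac{-d}{p})=-1$. For a nonnegative integer $n$ put $$S_n(d,p)=\det\left[(j^2+dk^2)^n\right]_{1\le j,k\le (p-1)/2}$$ (with the convention $x^0=1$). For rational numbers $x,y$, $x\equiv y\pmod p$ means that $x-y=p\,\frac ab$ for some integers $a,b$ with $p\nmid b$. (i) We have $\left(\frac{S_{p-2}(d,p)}{p}\right)=\left(\frac 2p\right)$. Moreover, $$\det\left[\frac1{j^2+dk^2}\right]_{1\le j,k\le (p-1)/2}\equiv\begin{cases}d^{(p-1)/4}\pmod p&\text{if }p\equiv1\pmod 4,\\(-1)^{(p+1)/4}\pmod p&\text{if }p\equiv3\pmod 4.\end{cases}$$ (ii) We have $\left(\frac{S_{p-3}(d,p)}{p}\right)=\frac{1-(\frac{-1}{p})}2$. Moreover, if $p\equiv3\pmod 4$ then $$\det\left[\frac1{(j^2+dk^2)^2}\right]_{1\le j,k\le (p-1)/2}\equiv\frac14\prod_{r=1}^{(p-3)/4}\left(r+\frac14\right)^2\pmod p,$$ where an empty product equals $1$. -/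

import Mathlib

/-- Congruence modulo `p` of rational numbers: `x ≡ y (mod p)` means that
`x - y = p * (a / b)` for some integers `a`, `b` with `p ∤ b`. -/
def RatCongr (p : ℕ) (x y : ℚ) : Prop :=
  ∃ a b : ℤ, ¬ (p : ℤ) ∣ b ∧ x - y = (p : ℚ) * ((a : ℚ) / (b : ℚ))

/-- The determinant `S_n(d,p) = det [(j² + d k²)ⁿ]`, `1 ≤ j, k ≤ (p-1)/2`
(the index `i : Fin ((p-1)/2)` stands for `i + 1`). -/
def detS (n : ℕ) (d : ℤ) (p : ℕ) : ℤ :=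
  (Matrix.of fun j k : Fin ((p - 1) / 2) =>
    (((j : ℕ) + 1 : ℤ) ^ 2 + d * ((k : ℕ) + 1 : ℤ) ^ 2) ^ n).det

/-- The rational determinant `det [1 / (j² + d k²)ᵐ]`, `1 ≤ j, k ≤ (p-1)/2`. -/
def detInv (m : ℕ) (d : ℤ) (p : ℕ) : ℚ :=
  (Matrix.of fun j k : Fin ((p - 1) / 2) =>
    1 / (((j : ℕ) + 1 : ℚ) ^ 2 + (d : ℚ) * ((k : ℕ) + 1 : ℚ) ^ 2) ^ m).det

/-!
Put `n = (p - 1) / 2`. Modulo `p` the numbers `x_j = j²` are the `n` distinct `n`-th roots of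
unity, and the hypothesis on `d` says `(-d) ^ n = -1`. Hence `u = x_i / (-d x_j)` satisfies
`u ^ n = -1`, and on such `u` the functions `1 / (1 - u)` and `1 / (1 - u)²` coincide with the
polynomials `∑_{r < n} u ^ r / 2` and `∑_{r < n} (2 r + 2 - n) / 4 * u ^ r`
(`inv_one_sub_eq_sum`, `inv_one_sub_sq_eq_sum`). As
`x_i + d x_j = d x_j (1 - u)`, both matrices are, up to scaling the columns, of the form
`∑_r c_r (x_i / x_j) ^ r`. Such a matrix is diagonalised by a Vandermonde matrix, and its
determinant is `∏_r n c_r` (`det_sum_div_pow`, `det_inv_add_pow`). This evaluates both determinants in `ZMod p`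
(`det_inv_add`, `det_inv_add_sq`); in the second one the factors `r + 5/4` pair up
under `r ↦ n - 2 - r` because `n = -1/2` in `ZMod p`.

For the Legendre symbols, `a ^ (p - 2) = a⁻¹` and `a ^ (p - 3) = a⁻²` for `a ≠ 0`. For the rational
determinants, `Reduces p` compares a `p`-integral rational with its residue and is compatible with
the ring operations, so it passes from the entries to the determinants.
-/

open Finset

/-! ### Reduction of `p`-integral rationals -/

/-- `Reduces p x u`: the rational `x` is `p`-integral and its residue class is `u`. -/
def Reduces (p : ℕ) [Fact p.Prime] (x : ℚ) (u : ZMod p) : Prop :=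
  ∃ a b : ℤ, (b : ZMod p) ≠ 0 ∧ x = a / b ∧ u = a / b

namespace Reduces

variable {p : ℕ} [Fact p.Prime] {x y : ℚ} {u v : ZMod p}

theorem int_ne_zero {b : ℤ} (hb : (b : ZMod p) ≠ 0) : (b : ℚ) ≠ 0 := by
  rintro h
  apply hb
  rw [Int.cast_eq_zero.mp h, Int.cast_zero]

theorem intCast (a : ℤ) : Reduces p a a := ⟨a, 1, by simp, by simp, by simp⟩

theorem add (hx : Reduces p x u) (hy : Reduces p y v) : Reduces p (x + y) (u + v) := by
  obtain ⟨a, b, hb, rfl, rfl⟩ := hx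
  obtain ⟨a', b', hb', rfl, rfl⟩ := hy
  have := int_ne_zero hb
  have := int_ne_zero hb'
  refine ⟨a * b' + b * a', b * b', by push_cast; exact mul_ne_zero hb hb', ?_, ?_⟩ <;>
  · push_cast
    rw [div_add_div _ _ ‹_› ‹_›]

theorem mul (hx : Reduces p x u) (hy : Reduces p y v) : Reduces p (x * y) (u * v) := by
  obtain ⟨a, b, hb, rfl, rfl⟩ := hx
  obtain ⟨a', b', hb', rfl, rfl⟩ := hy
  refine ⟨a * a', b * b', by push_cast; exact mul_ne_zero hb hb', ?_, ?_⟩ <;>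
  · push_cast
    rw [div_mul_div_comm]

theorem inv (hx : Reduces p x u) (hu : u ≠ 0) : Reduces p x⁻¹ u⁻¹ := by
  obtain ⟨a, b, hb, rfl, rfl⟩ := hx
  exact ⟨b, a, (div_ne_zero_iff.mp hu).1, inv_div _ _, inv_div _ _⟩

theorem div (hx : Reduces p x u) (hy : Reduces p y v) (hv : v ≠ 0) :
    Reduces p (x / y) (u / v) := by
  simpa only [div_eq_mul_inv] using hx.mul (hy.inv hv)

theorem sum {ι : Type*} (s : Finset ι) {f : ι → ℚ} {g : ι → ZMod p}
    (h : ∀ i ∈ s, Reduces p (f i) (g i)) : Reduces p (∑ i ∈ s, f i) (∑ i ∈ s, g i) := by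
  classical
  induction s using Finset.induction_on with
  | empty => simpa using intCast (p := p) 0
  | insert i s hi ih =>
    rw [sum_insert hi, sum_insert hi]
    exact (h i (mem_insert_self i s)).add (ih fun j hj => h j (mem_insert_of_mem hj))

theorem prod {ι : Type*} (s : Finset ι) {f : ι → ℚ} {g : ι → ZMod p}
    (h : ∀ i ∈ s, Reduces p (f i) (g i)) : Reduces p (∏ i ∈ s, f i) (∏ i ∈ s, g i) := by
  classical
  induction s using Finset.induction_on with
  | empty => simpa using intCast (p := p) 1
  | insert i s hi ih =>
    rw [prod_insert hi, prod_insert hi]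
    exact (h i (mem_insert_self i s)).mul (ih fun j hj => h j (mem_insert_of_mem hj))

theorem pow (hx : Reduces p x u) (n : ℕ) : Reduces p (x ^ n) (u ^ n) := by
  simpa using prod (range n) fun _ _ => hx

theorem det {ι : Type*} [Fintype ι] [DecidableEq ι] {M : Matrix ι ι ℚ} {N : Matrix ι ι (ZMod p)}
    (h : ∀ i j, Reduces p (M i j) (N i j)) : Reduces p M.det N.det := by
  rw [Matrix.det_apply', Matrix.det_apply']
  exact sum _ fun σ _ => (intCast _).mul (prod _ fun i _ => h _ _)

theorem ratCongr (hx : Reduces p x u) (hy : Reduces p y u) : RatCongr p x y := by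
  obtain ⟨a, b, hb, rfl, rfl⟩ := hx
  obtain ⟨a', b', hb', rfl, h⟩ := hy
  rw [div_eq_div_iff hb hb'] at h
  have hdvd : (p : ℤ) ∣ a * b' - b * a' := by
    rw [← ZMod.intCast_zmod_eq_zero_iff_dvd]
    push_cast
    rw [h]
    ring
  obtain ⟨c, hc⟩ := hdvd
  refine ⟨c, b * b', ?_, ?_⟩
  · rw [← ZMod.intCast_zmod_eq_zero_iff_dvd]
    push_cast
    exact mul_ne_zero hb hb'
  · rw [div_sub_div _ _ (int_ne_zero hb) (int_ne_zero hb')]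
    have hc' : (a * b' - b * a' : ℚ) = p * c := by exact_mod_cast hc
    rw [hc']
    push_cast
    ring

end Reduces

/-! ### Determinants over the roots of unity -/

section RootsOfUnity

variable {K : Type*} [Field K] {n : ℕ}

theorem inv_one_sub_eq_sum (h2 : (2 : K) ≠ 0) {u : K} (hu : u ^ n = -1) :
    (1 - u)⁻¹ = ∑ r ∈ range n, 1 / 2 * u ^ r := by
  have h := mul_neg_geom_sum u n
  refine inv_eq_of_mul_eq_one_right ?_
  rw [← mul_sum, mul_left_comm, h, hu]
  field_simp
  norm_num

theorem inv_one_sub_sq_eq_sum (h2 : (2 : K) ≠ 0) {u : K} (hu : u ^ n = -1) (hu1 : 1 - u ≠ 0) :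
    ((1 - u) ^ 2)⁻¹ = ∑ r ∈ range n, (2 * (r : K) + 2 - n) / 4 * u ^ r := by
  have h4 : (4 : K) ≠ 0 := by
    have := mul_ne_zero h2 h2
    norm_num at this
    exact this
  -- Multiplying by `1 - u` leaves a telescoping sum and the previous expansion.
  have key : (1 - u) * ∑ r ∈ range n, (2 * (r : K) + 2 - n) / 4 * u ^ r
      = ∑ r ∈ range n, 1 / 2 * u ^ r := by
    have htel := sum_range_sub' (fun r : ℕ => (2 * (r : K) - n) / 4 * u ^ r) n
    have hsplit : (1 - u) * ∑ r ∈ range n, (2 * (r : K) + 2 - n) / 4 * u ^ r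
        = ∑ r ∈ range n, 1 / 2 * u ^ r + ∑ r ∈ range n,
          ((2 * (r : K) - n) / 4 * u ^ r - (2 * ((r + 1 : ℕ) : K) - n) / 4 * u ^ (r + 1)) := by
      rw [mul_sum, ← sum_add_distrib]
      refine sum_congr rfl fun r _ => ?_
      push_cast
      field_simp
      ring
    rw [hsplit, htel, hu]
    push_cast
    ring
  rw [← inv_one_sub_eq_sum h2 hu] at key
  rw [sq, mul_inv]
  nth_rewrite 2 [← key]
  rw [inv_mul_cancel_left₀ hu1]

/-- The `x i` being all the `n`-th roots of unity, the matrix is `V * diagonal c * W` with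
`V = (x_i ^ r)` and `W = (x_j ^ (-r))`, and `V * W = n`. -/
theorem det_sum_div_pow {x : Fin n → K} (hx : Function.Injective x) (hxn : ∀ i, x i ^ n = 1)
    (c : ℕ → K) :
    (Matrix.of fun i j => ∑ r ∈ range n, c r * (x i / x j) ^ r).det
      = ∏ r ∈ range n, (n * c r) := by
  let V : Matrix (Fin n) (Fin n) K := Matrix.of fun i r => x i ^ (r : ℕ)
  let W : Matrix (Fin n) (Fin n) K := Matrix.of fun r j => (x j ^ (r : ℕ))⁻¹
  have hx0 : ∀ i, x i ≠ 0 := by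
    intro i h
    have := hxn i
    rw [h, zero_pow (Nat.ne_of_gt i.pos)] at this
    exact zero_ne_one this
  have hVW : V * W = Matrix.diagonal fun _ => (n : K) := by
    ext i j
    have hsum : (V * W) i j = ∑ r ∈ range n, (x i / x j) ^ r := by
      rw [Matrix.mul_apply, ← Fin.sum_univ_eq_sum_range]
      refine sum_congr rfl fun r _ => ?_
      rw [div_pow, div_eq_mul_inv]
      rfl
    rw [hsum]
    by_cases hij : i = j
    · subst hij
      simp [div_self (hx0 i)]
    · rw [Matrix.diagonal_apply_ne _ hij]
      have h := mul_neg_geom_sum (x i / x j) n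
      rw [div_pow, hxn, hxn, div_one, sub_self] at h
      refine (mul_eq_zero.mp h).resolve_left fun h1 => hij (hx ?_)
      exact (div_eq_one_iff_eq (hx0 j)).mp (sub_eq_zero.mp h1).symm
  have hdet : V.det * W.det = ∏ _r ∈ range n, (n : K) := by
    rw [← Matrix.det_mul, hVW, Matrix.det_diagonal]
    simp
  have hM : (Matrix.of fun i j => ∑ r ∈ range n, c r * (x i / x j) ^ r)
      = V * Matrix.diagonal (fun r : Fin n => c r) * W := by
    ext i j
    rw [Matrix.mul_apply, Matrix.of_apply, ← Fin.sum_univ_eq_sum_range]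
    refine sum_congr rfl fun r _ => ?_
    rw [Matrix.mul_diagonal]
    rw [div_pow, div_eq_mul_inv, ← mul_assoc, mul_comm (c r)]
    rfl
  rw [hM, Matrix.det_mul, Matrix.det_mul, Matrix.det_diagonal, mul_right_comm, hdet,
    Fin.prod_univ_eq_prod_range, ← prod_mul_distrib]

theorem prod_roots_of_unity {x : Fin n → K} (hn : n ≠ 0) (hx : Function.Injective x)
    (hxn : ∀ i, x i ^ n = 1) : ∏ i, x i = (-1) ^ (n + 1) := by
  classical
  open Polynomial in
  have hpoly : (X ^ n - 1 : K[X]) = ∏ i, (X - C (x i)) := by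
    refine eq_of_degree_sub_lt_of_eval_finset_eq (univ.image x) ?_ ?_
    · rw [card_image_of_injective _ hx, card_univ, Fintype.card_fin]
      have h1 : (X ^ n - 1 : K[X]).degree = n := by
        simpa using degree_X_pow_sub_C (Nat.pos_of_ne_zero hn) (1 : K)
      have h2 : (∏ i, (X - C (x i))).degree = (n : WithBot ℕ) := by
        rw [degree_prod]
        simp
      rw [← h1]
      refine degree_sub_lt_left (h1.trans h2.symm) ?_ ?_
      · intro h
        rw [h] at h1
        simp at h1
      · rw [(monic_prod_of_monic _ _ fun i _ => monic_X_sub_C (x i)).leadingCoeff]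
        simpa using leadingCoeff_X_pow_sub_C (Nat.pos_of_ne_zero hn) (r := (1 : K))
    · intro y hy
      obtain ⟨i, -, rfl⟩ := mem_image.mp hy
      rw [eval_prod, prod_eq_zero (mem_univ i) (by simp)]
      simp [hxn]
  have h := congrArg (Polynomial.eval 0) hpoly
  rw [Polynomial.eval_prod] at h
  simp only [Polynomial.eval_sub, Polynomial.eval_pow, Polynomial.eval_X, Polynomial.eval_one,
    Polynomial.eval_C, zero_sub, zero_pow hn, prod_neg, card_univ, Fintype.card_fin] at h
  have hs : ((-1 : K) ^ n) * (-1) ^ n = 1 := by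
    rw [← mul_pow]
    simp
  calc ∏ i, x i = (-1) ^ n * (-1) ^ n * ∏ i, x i := by rw [hs, one_mul]
    _ = (-1) ^ (n + 1) := by rw [mul_assoc, ← h, pow_succ]

/-- If `(1 - u)⁻ᵐ` is given by a polynomial with coefficients `c` wherever `u ^ n = -1`, the
determinant of the powers `(x_i + d x_j)⁻ᵐ` is a product of these coefficients. -/
theorem det_inv_add_pow {x : Fin n → K} (hx : Function.Injective x)
    (hxn : ∀ i, x i ^ n = 1) {d : K} (hd : (-d) ^ n = -1) (h2 : (2 : K) ≠ 0) (m : ℕ) (c : ℕ → K)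
    (hc : ∀ u : K, u ^ n = -1 → 1 - u ≠ 0 →
      ((1 - u) ^ m)⁻¹ = ∑ r ∈ range n, c r * u ^ r) :
    (Matrix.of fun i j => ((x i + d * x j) ^ m)⁻¹).det
      = ((d ^ n * ∏ i, x i) ^ m)⁻¹ * ((-d)⁻¹ ^ (n * (n - 1) / 2) * ∏ r ∈ range n, (n * c r)) := by
  have h1 : (1 : K) ≠ -1 := by
    intro h
    apply h2
    linear_combination h
  have hx0 : ∀ i, x i ≠ 0 := by
    intro i h
    have := hxn i
    rw [h, zero_pow (Nat.ne_of_gt i.pos)] at this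
    exact zero_ne_one this
  have hM : (Matrix.of fun i j => ((x i + d * x j) ^ m)⁻¹)
      = Matrix.of fun i j => ((d * x j) ^ m)⁻¹ * (Matrix.of fun i j =>
        ∑ r ∈ range n, (c r * (-d)⁻¹ ^ r) * (x i / x j) ^ r) i j := by
    ext i j
    have hd0 : d ≠ 0 := by
      rintro rfl
      rw [neg_zero, zero_pow (Nat.ne_of_gt i.pos)] at hd
      exact neg_ne_zero.mpr one_ne_zero hd.symm
    have hu : ((-d)⁻¹ * (x i / x j)) ^ n = -1 := by
      rw [mul_pow, inv_pow, hd, div_pow, hxn, hxn]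
      norm_num
    have hu1 : 1 - (-d)⁻¹ * (x i / x j) ≠ 0 := by
      intro h
      rw [← sub_eq_zero.mp h, one_pow] at hu
      exact h1 hu
    have hfac : x i + d * x j = (d * x j) * (1 - (-d)⁻¹ * (x i / x j)) := by
      have := hx0 j
      field_simp
      ring
    simp only [Matrix.of_apply]
    rw [hfac, mul_pow, mul_inv, hc _ hu hu1]
    congr 1
    refine sum_congr rfl fun r _ => ?_
    rw [mul_pow, mul_assoc]
  rw [hM, Matrix.det_mul_row, det_sum_div_pow hx hxn]
  congr 1
  · rw [prod_inv_distrib, prod_pow, prod_mul_distrib]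
    simp
  · rw [← sum_range_id, ← prod_pow_eq_pow_sum, ← prod_mul_distrib]
    refine prod_congr rfl fun r _ => ?_
    ring

end RootsOfUnity

/-! ### The squares modulo `p` -/

section ZModSquares

variable {p : ℕ} [Fact p.Prime]

theorem two_ne_zero_zmod (hp : p ≠ 2) : (2 : ZMod p) ≠ 0 := by
  have : Fact (2 < p) := ⟨lt_of_le_of_ne (Fact.out : p.Prime).two_le hp.symm⟩
  exact Ring.two_ne_zero (by rwa [ZMod.ringChar_zmod_n])

theorem four_ne_zero_zmod (hp : p ≠ 2) : (4 : ZMod p) ≠ 0 := by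
  rw [show (4 : ZMod p) = 2 * 2 by norm_num]
  exact mul_ne_zero (two_ne_zero_zmod hp) (two_ne_zero_zmod hp)

theorem two_mul_half_zmod (hp : p ≠ 2) : 2 * (((p - 1) / 2 : ℕ) : ZMod p) = -1 := by
  have hodd := (Fact.out : p.Prime).eq_two_or_odd.resolve_left hp
  have h : 2 * ((p - 1) / 2) + 1 = p := by omega
  have h' := congrArg (Nat.cast : ℕ → ZMod p) h
  push_cast at h'
  rw [ZMod.natCast_self] at h'
  linear_combination h'

theorem natCast_zmod_ne_zero {a : ℕ} (h0 : 0 < a) (ha : a < p) : (a : ZMod p) ≠ 0 := by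
  rw [Ne, ZMod.natCast_eq_zero_iff]
  exact Nat.not_dvd_of_pos_of_lt h0 ha

theorem squares_injective :
    Function.Injective fun i : Fin ((p - 1) / 2) => (((i : ℕ) : ZMod p) + 1) ^ 2 := by
  intro i j hij
  have hi := i.isLt
  have hj := j.isLt
  rcases sq_eq_sq_iff_eq_or_eq_neg.mp hij with h | h
  · have h' : (((i : ℕ) + 1 : ℕ) : ZMod p) = ((j : ℕ) + 1 : ℕ) := by exact_mod_cast h
    have := CharP.natCast_injOn_Iio (ZMod p) p (Set.mem_Iio.mpr (by omega))
      (Set.mem_Iio.mpr (by omega)) h'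
    exact Fin.ext (by omega)
  · refine absurd ?_ (natCast_zmod_ne_zero (p := p) (a := (i : ℕ) + 1 + (j + 1)) (by omega)
      (by omega))
    push_cast
    rw [h]
    ring

theorem squares_pow_half (hp : p ≠ 2) (i : Fin ((p - 1) / 2)) :
    ((((i : ℕ) : ZMod p) + 1) ^ 2) ^ ((p - 1) / 2) = 1 := by
  have hi := i.isLt
  have hodd := (Fact.out : p.Prime).eq_two_or_odd.resolve_left hp
  rw [← pow_mul, show 2 * ((p - 1) / 2) = p - 1 by omega]
  have := natCast_zmod_ne_zero (p := p) (a := (i : ℕ) + 1) (by omega) (by omega)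
  push_cast at this
  exact ZMod.pow_card_sub_one_eq_one this

/-- Since `n = -1/2`, the factor `n ^ n` and the powers of two cancel up to sign. -/
theorem half_div_two_pow (hp : p ≠ 2) :
    (((p - 1) / 2 : ℕ) * (1 / 2) : ZMod p) ^ ((p - 1) / 2) = (-1) ^ ((p - 1) / 2) := by
  have h2 := two_ne_zero_zmod hp
  have hodd := (Fact.out : p.Prime).eq_two_or_odd.resolve_left hp
  have h : (((p - 1) / 2 : ℕ) * (1 / 2) : ZMod p) = -1 * (2⁻¹) ^ 2 := by
    field_simp
    linear_combination two_mul_half_zmod hp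
  rw [h, mul_pow, ← pow_mul, show 2 * ((p - 1) / 2) = p - 1 by omega,
    ZMod.pow_card_sub_one_eq_one (inv_ne_zero h2), mul_one]

/-- The matrix `((j² + d k²)⁻ᵐ)` over `ZMod p`, indexed as in `detS` and `detInv`. -/
def invMatrix (p : ℕ) [Fact p.Prime] (m : ℕ) (d : ZMod p) :
    Matrix (Fin ((p - 1) / 2)) (Fin ((p - 1) / 2)) (ZMod p) :=
  Matrix.of fun i j => (((((i : ℕ) : ZMod p) + 1) ^ 2 + d * (((j : ℕ) : ZMod p) + 1) ^ 2) ^ m)⁻¹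

theorem pow_half_mul_prod_squares (hp : p ≠ 2) {d : ZMod p} (hd : (-d) ^ ((p - 1) / 2) = -1) :
    d ^ ((p - 1) / 2) * ∏ i : Fin ((p - 1) / 2), (((i : ℕ) : ZMod p) + 1) ^ 2 = 1 := by
  have hn : (p - 1) / 2 ≠ 0 := by
    have := (Fact.out : p.Prime).two_le
    omega
  rw [prod_roots_of_unity hn squares_injective (squares_pow_half hp), pow_succ, ← mul_assoc,
    ← mul_pow, mul_neg_one d, hd, neg_one_mul, neg_neg]

theorem det_inv_add (hp : p ≠ 2) {d : ZMod p} (hd : (-d) ^ ((p - 1) / 2) = -1) :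
    (invMatrix p 1 d).det
      = (-1) ^ ((p - 1) / 2) * (-d)⁻¹ ^ ((p - 1) / 2 * ((p - 1) / 2 - 1) / 2) := by
  have h2 := two_ne_zero_zmod hp
  rw [invMatrix, det_inv_add_pow squares_injective (squares_pow_half hp) hd h2 1 (fun _ => 1 / 2)
    fun u hu _ => by rw [pow_one]; exact inv_one_sub_eq_sum h2 hu,
    pow_half_mul_prod_squares hp hd, prod_const, card_range, half_div_two_pow hp]
  ring

theorem det_inv_add_sq (hp : p ≠ 2) {d : ZMod p} (hd : (-d) ^ ((p - 1) / 2) = -1) :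
    (invMatrix p 2 d).det
      = (-1) ^ ((p - 1) / 2) * (-d)⁻¹ ^ ((p - 1) / 2 * ((p - 1) / 2 - 1) / 2) *
        ∏ r ∈ range ((p - 1) / 2), ((r : ZMod p) + 5 / 4) := by
  have h2 := two_ne_zero_zmod hp
  have h4 : (4 : ZMod p) = 2 * 2 := by norm_num
  have hcoef : ∀ r : ℕ, (((p - 1) / 2 : ℕ) : ZMod p) *
      ((2 * (r : ZMod p) + 2 - ((p - 1) / 2 : ℕ)) / 4)
      = ((p - 1) / 2 : ℕ) * (1 / 2) * ((r : ZMod p) + 5 / 4) := by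
    intro r
    have : (((p - 1) / 2 : ℕ) : ZMod p) = -1 / 2 := by
      field_simp
      linear_combination two_mul_half_zmod hp
    rw [this, h4]
    field_simp
    ring
  rw [invMatrix, det_inv_add_pow squares_injective (squares_pow_half hp) hd h2 2 _
    fun u hu hu1 => inv_one_sub_sq_eq_sum h2 hu hu1, pow_half_mul_prod_squares hp hd]
  simp only [hcoef]
  rw [prod_mul_distrib, prod_const, card_range, half_div_two_pow hp]
  ring

/-- For `p = 2 n + 1` with `n = 2 q + 1`, the factors at `r` and `n - 2 - r` are opposite. -/
theorem prod_add_five_quarters {q : ℕ} (hq : p = 4 * q + 3) :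
    ∏ r ∈ range (2 * q + 1), ((r : ZMod p) + 5 / 4)
      = -((-1) ^ q * (1 / 4 * ∏ r ∈ Icc 1 q, ((r : ZMod p) + 1 / 4) ^ 2)) := by
  have h4 := four_ne_zero_zmod (p := p) (by omega)
  have hp0 : (4 * q + 3 : ZMod p) = 0 := by
    have := congrArg (Nat.cast : ℕ → ZMod p) hq
    rw [ZMod.natCast_self] at this
    push_cast at this
    exact this.symm
  have hIcc : ∏ r ∈ Icc 1 q, ((r : ZMod p) + 1 / 4) ^ 2
      = ∏ r ∈ range q, ((r : ZMod p) + 5 / 4) ^ 2 := by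
    rw [← Ico_add_one_right_eq_Icc, prod_Ico_eq_prod_range]
    refine prod_congr rfl fun r _ => ?_
    push_cast
    field_simp
    ring
  have hrefl : ∏ r ∈ range q, (((q + r : ℕ) : ZMod p) + 5 / 4)
      = ∏ r ∈ range q, (-1 * ((r : ZMod p) + 5 / 4)) := by
    rw [← prod_range_reflect]
    refine prod_congr rfl fun r hr => ?_
    have hr := mem_range.mp hr
    have h : q + (q - 1 - r) + (r + 1) = 2 * q := by omega
    have h' := congrArg (Nat.cast : ℕ → ZMod p) h
    push_cast at h' ⊢
    field_simp
    linear_combination 4 * h' + 2 * hp0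
  rw [prod_range_succ, two_mul, prod_range_add, hrefl, prod_mul_distrib, prod_const, card_range,
    hIcc, prod_pow, sq]
  have hlast : (((q + q : ℕ) : ZMod p) + 5 / 4) = -(1 / 4) := by
    push_cast
    field_simp
    linear_combination 2 * hp0
  rw [hlast]
  ring

/-! ### Evaluation according to `p` modulo `4` -/

theorem det_inv_add_of_mod_four_eq_one {q : ℕ} (hq : p = 4 * q + 1) {d : ZMod p}
    (hd : (-d) ^ ((p - 1) / 2) = -1) : (invMatrix p 1 d).det = d ^ q := by
  have hn : (p - 1) / 2 = 2 * q := by omega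
  have hq0 : q ≠ 0 := by
    rintro rfl
    exact (Fact.out : p.Prime).ne_one (by omega)
  rw [det_inv_add (by omega) hd]
  rw [hn] at hd ⊢
  have hexp : 2 * q * (2 * q - 1) / 2 = q * (2 * q - 1) := by
    rw [mul_assoc, Nat.mul_div_cancel_left _ two_pos]
  rw [hexp, (even_two_mul q).neg_one_pow, one_mul, inv_pow]
  refine inv_eq_of_mul_eq_one_right ?_
  have hd' : d ^ q = (-1) ^ q * (-d) ^ q := by
    rw [← mul_pow]
    simp
  have hodd : q * (2 * q - 1) + q = 2 * q * q := by
    obtain ⟨k, rfl⟩ := Nat.exists_eq_succ_of_ne_zero hq0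
    rw [show 2 * k.succ - 1 = 2 * k + 1 by omega, Nat.succ_eq_add_one]
    ring
  rw [hd', mul_left_comm, ← pow_add, hodd, pow_mul, hd, ← mul_pow]
  simp

theorem inv_pow_of_mod_four_eq_three {q : ℕ} (hq : p = 4 * q + 3) {d : ZMod p}
    (hd : (-d) ^ ((p - 1) / 2) = -1) :
    (-1) ^ ((p - 1) / 2) * (-d)⁻¹ ^ ((p - 1) / 2 * ((p - 1) / 2 - 1) / 2) = (-1) ^ (q + 1) := by
  have hn : (p - 1) / 2 = 2 * q + 1 := by omega
  rw [hn] at hd ⊢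
  have hexp : (2 * q + 1) * (2 * q + 1 - 1) / 2 = (2 * q + 1) * q := by
    rw [Nat.add_sub_cancel, mul_left_comm, Nat.mul_div_cancel_left _ two_pos]
  rw [hexp, pow_mul, inv_pow, hd, (odd_two_mul_add_one q).neg_one_pow, pow_succ, mul_comm]
  norm_num

theorem det_inv_add_of_mod_four_eq_three {q : ℕ} (hq : p = 4 * q + 3) {d : ZMod p}
    (hd : (-d) ^ ((p - 1) / 2) = -1) : (invMatrix p 1 d).det = (-1) ^ (q + 1) := by
  rw [det_inv_add (by omega) hd, inv_pow_of_mod_four_eq_three hq hd]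

theorem det_inv_add_sq_of_mod_four_eq_one {q : ℕ} (hq : p = 4 * q + 1) {d : ZMod p}
    (hd : (-d) ^ ((p - 1) / 2) = -1) : (invMatrix p 2 d).det = 0 := by
  have hq0 : q ≠ 0 := by
    rintro rfl
    exact (Fact.out : p.Prime).ne_one (by omega)
  have h4 := four_ne_zero_zmod (p := p) (by omega)
  rw [det_inv_add_sq (by omega) hd]
  -- The factor at `r = q - 1` is `(4 q + 1) / 4 = p / 4`.
  rw [prod_eq_zero (i := q - 1) (mem_range.mpr (by omega)), mul_zero]
  have hp0 : 4 * (q - 1) + 5 = p := by omega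
  have := congrArg (Nat.cast : ℕ → ZMod p) hp0
  rw [ZMod.natCast_self] at this
  push_cast at this
  field_simp
  linear_combination this

theorem det_inv_add_sq_of_mod_four_eq_three {q : ℕ} (hq : p = 4 * q + 3) {d : ZMod p}
    (hd : (-d) ^ ((p - 1) / 2) = -1) :
    (invMatrix p 2 d).det = 1 / 4 * ∏ r ∈ Icc 1 q, ((r : ZMod p) + 1 / 4) ^ 2 := by
  have hs : (-1 : ZMod p) ^ q * (-1) ^ q = 1 := by
    rw [← mul_pow]
    simp
  rw [det_inv_add_sq (by omega) hd, inv_pow_of_mod_four_eq_three hq hd,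
    show (p - 1) / 2 = 2 * q + 1 by omega, prod_add_five_quarters hq, pow_succ]
  linear_combination (1 / 4 * ∏ r ∈ Icc 1 q, ((r : ZMod p) + 1 / 4) ^ 2) * hs

theorem entry_ne_zero (hp : p ≠ 2) {d : ZMod p} (hd : (-d) ^ ((p - 1) / 2) = -1)
    (i j : Fin ((p - 1) / 2)) :
    (((i : ℕ) : ZMod p) + 1) ^ 2 + d * (((j : ℕ) : ZMod p) + 1) ^ 2 ≠ 0 := by
  intro h
  have h1 := squares_pow_half hp i
  rw [show (((i : ℕ) : ZMod p) + 1) ^ 2 = -d * (((j : ℕ) : ZMod p) + 1) ^ 2 by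
    linear_combination h, mul_pow, hd, squares_pow_half hp j] at h1
  apply two_ne_zero_zmod hp
  linear_combination -h1

theorem intCast_detS (hp : p ≠ 2) {d : ℤ} (hd : (-(d : ZMod p)) ^ ((p - 1) / 2) = -1) {n m : ℕ}
    (hnm : n + m = p - 1) : (detS n d p : ZMod p) = (invMatrix p m d).det := by
  rw [detS, ← eq_intCast (Int.castRingHom (ZMod p)), RingHom.map_det]
  congr 1
  ext i j
  have h0 := entry_ne_zero hp hd i j
  have h1 := (pow_add _ n m).symm.trans
    ((congrArg _ hnm).trans (ZMod.pow_card_sub_one_eq_one h0))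
  simpa [invMatrix] using eq_inv_of_mul_eq_one_left h1

theorem reduces_detInv (hp : p ≠ 2) {d : ℤ} (hd : (-(d : ZMod p)) ^ ((p - 1) / 2) = -1) (m : ℕ) :
    Reduces p (detInv m d p) (invMatrix p m d).det := by
  refine Reduces.det fun i j => ?_
  have h : Reduces p ((((i : ℕ) + 1 : ℚ) ^ 2 + (d : ℚ) * ((j : ℕ) + 1 : ℚ) ^ 2) ^ m)
      (((((i : ℕ) : ZMod p) + 1) ^ 2 + d * (((j : ℕ) : ZMod p) + 1) ^ 2) ^ m) := by
    have := Reduces.intCast (p := p)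
      ((((i : ℕ) + 1 : ℤ) ^ 2 + d * ((j : ℕ) + 1 : ℤ) ^ 2) ^ m)
    push_cast at this
    exact this
  rw [invMatrix, Matrix.of_apply, Matrix.of_apply, one_div]
  exact h.inv (pow_ne_zero _ (entry_ne_zero hp hd i j))

theorem legendreSym_of_intCast_eq {a b : ℤ} (h : (a : ZMod p) = b) :
    legendreSym p a = legendreSym p b := by
  rw [legendreSym, legendreSym, h]

theorem legendreSym_two_of_mod_four_eq_one {q : ℕ} (hq : p = 4 * q + 1) :
    legendreSym p 2 = (-1) ^ q := by
  rw [legendreSym.at_two (by omega), ZMod.χ₈_nat_mod_eight]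
  rcases Nat.even_or_odd' q with ⟨k, rfl | rfl⟩
  · rw [show p % 8 = 1 by omega, pow_mul]
    simp
  · rw [show p % 8 = 5 by omega, pow_succ, pow_mul]
    simp

theorem legendreSym_two_of_mod_four_eq_three {q : ℕ} (hq : p = 4 * q + 3) :
    legendreSym p 2 = (-1) ^ (q + 1) := by
  rw [legendreSym.at_two (by omega), ZMod.χ₈_nat_mod_eight]
  rcases Nat.even_or_odd' q with ⟨k, rfl | rfl⟩
  · rw [show p % 8 = 3 by omega, pow_succ, pow_mul]
    simp
  · rw [show p % 8 = 7 by omega, pow_succ, pow_succ, pow_mul]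
    simp

theorem legendreSym_pow (a : ℤ) (k : ℕ) : legendreSym p (a ^ k) = legendreSym p a ^ k := by
  rw [legendreSym, legendreSym, Int.cast_pow, map_pow]

end ZModSquares

theorem theorem1p2 (p : ℕ) [Fact p.Prime] (hp : p ≠ 2) (d : ℤ)
    (hd : legendreSym p (-d) = -1) :
    (legendreSym p (detS (p - 2) d p) = legendreSym p 2 ∧
      (p % 4 = 1 → RatCongr p (detInv 1 d p) ((d : ℚ) ^ ((p - 1) / 4))) ∧
      (p % 4 = 3 → RatCongr p (detInv 1 d p) ((-1 : ℚ) ^ ((p + 1) / 4)))) ∧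
    ((legendreSym p (detS (p - 3) d p) : ℚ) = (1 - (legendreSym p (-1) : ℚ)) / 2 ∧
      (p % 4 = 3 → RatCongr p (detInv 2 d p)
        (1 / 4 * ∏ r ∈ Finset.Icc (1 : ℕ) ((p - 3) / 4), ((r : ℚ) + 1 / 4) ^ 2))) := by
  have hodd := (Fact.out : p.Prime).eq_two_or_odd.resolve_left hp
  have hp2 := (Fact.out : p.Prime).two_le
  have hd' : (-(d : ZMod p)) ^ ((p - 1) / 2) = -1 := by
    have h := legendreSym.eq_pow p (-d)
    rw [hd, show p / 2 = (p - 1) / 2 by omega] at h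
    push_cast at h
    exact h.symm
  have hS2 := intCast_detS hp hd' (n := p - 2) (m := 1) (by omega)
  have hS3 := intCast_detS hp hd' (n := p - 3) (m := 2) (by omega)
  have hR1 := reduces_detInv hp hd' 1
  have hR2 := reduces_detInv hp hd' 2
  obtain h4 | h4 : p % 4 = 1 ∨ p % 4 = 3 := by omega
  · obtain ⟨q, hq⟩ : ∃ q, p = 4 * q + 1 := ⟨p / 4, by omega⟩
    have hneg : legendreSym p (-1) = 1 := by
      rw [legendreSym.at_neg_one hp, ZMod.χ₄_nat_one_mod_four h4]
    have hdd : legendreSym p d = -1 := by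
      have := legendreSym.mul p (-1) d
      rw [neg_one_mul, hd, hneg, one_mul] at this
      exact this.symm
    rw [det_inv_add_of_mod_four_eq_one hq hd'] at hS2 hR1
    rw [det_inv_add_sq_of_mod_four_eq_one hq hd'] at hS3
    refine ⟨⟨?_, fun _ => ?_, fun h => by omega⟩, ?_, fun h => by omega⟩
    · rw [legendreSym_of_intCast_eq (b := d ^ q) (by rw [hS2]; push_cast; rfl), legendreSym_pow,
        hdd, legendreSym_two_of_mod_four_eq_one hq]
    · rw [show (p - 1) / 4 = q by omega]
      exact hR1.ratCongr ((Reduces.intCast d).pow q)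
    · rw [(legendreSym.eq_zero_iff p _).mpr hS3, hneg]
      norm_num
  · obtain ⟨q, hq⟩ : ∃ q, p = 4 * q + 3 := ⟨p / 4, by omega⟩
    have hneg : legendreSym p (-1) = -1 := by
      rw [legendreSym.at_neg_one hp, ZMod.χ₄_nat_three_mod_four h4]
    have h40 := four_ne_zero_zmod hp
    rw [det_inv_add_of_mod_four_eq_three hq hd'] at hS2 hR1
    rw [det_inv_add_sq_of_mod_four_eq_three hq hd'] at hS3 hR2
    refine ⟨⟨?_, fun h => by omega, fun _ => ?_⟩, ?_, fun _ => ?_⟩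
    · rw [legendreSym_of_intCast_eq (b := (-1) ^ (q + 1)) (by rw [hS2]; push_cast; rfl),
        legendreSym_pow, hneg, legendreSym_two_of_mod_four_eq_three hq]
    · rw [show (p + 1) / 4 = q + 1 by omega]
      have := (Reduces.intCast (p := p) (-1)).pow (q + 1)
      push_cast at this
      exact hR1.ratCongr this
    · -- The residue is the square of `(1 / 2) ∏ (r + 1 / 4)`, nonzero as `0 < 4 r + 1 < p`.
      have hne : (detS (p - 3) d p : ZMod p) ≠ 0 := by
        rw [hS3]
        refine mul_ne_zero (one_div_ne_zero h40) (prod_ne_zero_iff.mpr fun r hr => pow_ne_zero 2 ?_)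
        have hr := mem_Icc.mp hr
        have h := natCast_zmod_ne_zero (p := p) (a := 4 * r + 1) (by omega) (by omega)
        push_cast at h
        intro h0
        apply h
        field_simp at h0
        linear_combination h0
      have hsq : IsSquare (detS (p - 3) d p : ZMod p) := by
        rw [hS3, prod_pow]
        refine ⟨1 / 2 * ∏ r ∈ Icc 1 q, ((r : ZMod p) + 1 / 4), ?_⟩
        rw [show (1 / 4 : ZMod p) = 1 / 2 * (1 / 2) by
          rw [div_mul_div_comm]
          norm_num]
        ring
      rw [(legendreSym.eq_one_iff p hne).mpr hsq, hneg]
      norm_num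
    · rw [show (p - 3) / 4 = q by omega]
      have h14 : Reduces p (1 / 4 : ℚ) (1 / 4) := by
        have := (Reduces.intCast (p := p) 1).div (Reduces.intCast 4) (by exact_mod_cast h40)
        push_cast at this
        exact this
      refine hR2.ratCongr (h14.mul (Reduces.prod _ fun r _ => Reduces.pow (Reduces.add ?_ h14) 2))
      simpa using Reduces.intCast (p := p) (r : ℤ)
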